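/- Let $X_1,\dots,X_n$ ($n\ge 2$) be independent random variables, each normally distributed with mean $\mu$ and variance $\sigma^2$, $\sigma>0$. Let $T$ be a target and $k>1$. Put $\bar X=\frac1n\sum_{i=1}^n X_i$, $S_n^2=\frac1n\sum_{i=1}^n (X_i-\bar X)^2$ and $S_{n-1}^2=\frac1{n-1}\sum_{i=1}^n(X_i-\bar X)^2$. Upper tolerance. Let $U>T$ and put $C_{pu}=\frac{U-T}{3\sigma}$. For $m\in\{n,n-1\}$ and real $u,v$ let $$\hat C_{pu,m}(u,v)=\frac{U-T-u\hat A_u^*}{3\sqrt{S_m^2+v\hat A_u^{*2}}},\qquad \hat A_u^*=\max\Bigl\{\bar X-T,\frac{T-\bar X}{k}\Bigr\},$$ and let $\hat C_{pu,m}=\hat C_{pu,m}(0,0)=\frac{U-T}{3S_m}$. Then the following hold. 1. If a lower limit $L$ is placed so that $T-L=k(U-T)$, and $C_p=\frac{U-L}{6\sigma}$, then $C_{pu}=\frac{2}{1+k}\,C_p$. 2. The law of $\hat C_{pu,n-1}$ has the Lebesgue density which is $0$ for $x\le 0$ and $$f_{\hat C_{pu,n-1}}(x)=\frac{(n-1)^{(n-1)/2}}{C_{pu}\,\Gamma\left(\frac{n-1}2\right)2^{(n-3)/2}}\left(\frac{C_{pu}}{x}\right)^{n}e^{-\frac{n-1}{2}\left(\frac{C_{pu}}{x}\right)^2},\qquad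 x>0.$$ For every integer $r$ with $0\le r<n-1$ the $r$-th moment is finite and $$E\left[\hat C_{pu,n-1}^{\,r}\right]=\left(\frac{n-1}{2}\right)^{r/2}\frac{\Gamma\left(\frac{n-1-r}{2}\right)}{\Gamma\left(\frac{n-1}{2}\right)}\,C_{pu}^{\,r}.$$ In particular, with $b_f=\sqrt{\frac{2}{n-1}}\;\frac{\Gamma((n-1)/2)}{\Gamma((n-2)/2)}$: if $n\ge 3$, the mean is finite and $E[\hat C_{pu,n-1}]=b_f^{-1}C_{pu}$; if $n\ge 4$, the variance is finite and $V(\hat C_{pu,n-1})=\left(\frac{n-1}{n-3}-b_f^{-2}\right)C_{pu}^2$. 3. $\hat C_{pu,n}=\left(\frac{n}{n-1}\right)^{1/2}\hat C_{pu,n-1}$. The law of $\hat C_{pu,n}$ has the Lebesgue density which is $0$ for $x\le 0$ and $$f_{\hat C_{pu,n}}(x)=\frac{n^{(n-1)/2}}{C_{pu}\,\Gamma\left(\frac{n-1}2\right)2^{(n-3)/2}}\left(\frac{C_{pu}}{x}\right)^{n}e^{-\frac{n}{2}\left(\frac{C_{pu}}{x}\right)^2},\qquad x>0.$$ For every integer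 $r$ with $0\le r<n-1$ the $r$-th moment is finite and $$E\left[\hat C_{pu,n}^{\,r}\right]=\left(\frac{n}{2}\right)^{r/2}\frac{\Gamma\left(\frac{n-1-r}{2}\right)}{\Gamma\left(\frac{n-1}{2}\right)}\,C_{pu}^{\,r}.$$ In particular, with $c_f=\sqrt{\frac{2}{n}}\;\frac{\Gamma((n-1)/2)}{\Gamma((n-2)/2)}$: if $n\ge 3$, the mean is finite and $E[\hat C_{pu,n}]=c_f^{-1}C_{pu}$; if $n\ge 4$, the variance is finite and $V(\hat C_{pu,n})=\left(\frac{n}{n-3}-c_f^{-2}\right)C_{pu}^2$. Lower tolerance. Let $L<T$ and put $C_{pl}=\frac{T-L}{3\sigma}$. For $m\in\{n,n-1\}$ and real $u,v$ let $$\hat C_{pl,m}(u,v)=\frac{T-L-u\hat A_l^*}{3\sqrt{S_m^2+v\hat A_l^{*2}}},\qquad \hat A_l^*=\max\Bigl\{\frac{\bar X-T}{k},T-\bar X\Bigr\},$$ and let $\hat C_{pl,m}=\hat C_{pl,m}(0,0)=\frac{T-L}{3S_m}$. If an upper limit $U$ is placed so that $U-T=k(T-L)$, then $C_{pl}=\frac{2}{1+k}C_p$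 with $C_p=\frac{U-L}{6\sigma}$. All assertions of 2 and 3 hold with $C_{pu},\hat C_{pu,n-1},\hat C_{pu,n}$ replaced by $C_{pl},\hat C_{pl,n-1},\hat C_{pl,n}$. -/

import Mathlib

open MeasureTheory ProbabilityTheory

noncomputable section

namespace Capability

/-- Bilateral potential capability index `C_p = (U - L) / (6 σ)`. -/
def Cp (L U σ : ℝ) : ℝ := (U - L) / (6 * σ)

/-- Potential capability index for a single upper tolerance limit `U` and target `T`. -/
def Cpu (U T σ : ℝ) : ℝ := (U - T) / (3 * σ)

/-- Potential capability index for a single lower tolerance limit `L` and target `T`. -/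
def Cpl (L T σ : ℝ) : ℝ := (T - L) / (3 * σ)

/-- Sample mean of a sample `x` of size `n`. -/
def sampleMean {n : ℕ} (x : Fin n → ℝ) : ℝ := (∑ i, x i) / n

/-- Sample variance with divisor `n`. -/
def sampleVarN {n : ℕ} (x : Fin n → ℝ) : ℝ :=
  (∑ i, (x i - sampleMean x) ^ 2) / n

/-- Sample variance with divisor `n - 1`. -/
def sampleVarNm1 {n : ℕ} (x : Fin n → ℝ) : ℝ :=
  (∑ i, (x i - sampleMean x) ^ 2) / ((n : ℝ) - 1)

/-- Estimated penalized deviation from the target, upper tolerance. -/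
def devU (T k : ℝ) {n : ℕ} (x : Fin n → ℝ) : ℝ :=
  max (sampleMean x - T) ((T - sampleMean x) / k)

/-- Estimated penalized deviation from the target, lower tolerance. -/
def devL (T k : ℝ) {n : ℕ} (x : Fin n → ℝ) : ℝ :=
  max ((sampleMean x - T) / k) (T - sampleMean x)

/-- The estimator `Ĉ_{pu,n}(u,v)`. -/
def estUFamilyN (U T k u v : ℝ) {n : ℕ} (x : Fin n → ℝ) : ℝ :=
  (U - T - u * devU T k x) / (3 * Real.sqrt (sampleVarN x + v * devU T k x ^ 2))

/-- The estimator `Ĉ_{pu,n-1}(u,v)`. -/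
def estUFamilyNm1 (U T k u v : ℝ) {n : ℕ} (x : Fin n → ℝ) : ℝ :=
  (U - T - u * devU T k x) / (3 * Real.sqrt (sampleVarNm1 x + v * devU T k x ^ 2))

/-- The estimator `Ĉ_{pl,n}(u,v)`. -/
def estLFamilyN (L T k u v : ℝ) {n : ℕ} (x : Fin n → ℝ) : ℝ :=
  (T - L - u * devL T k x) / (3 * Real.sqrt (sampleVarN x + v * devL T k x ^ 2))

/-- The estimator `Ĉ_{pl,n-1}(u,v)`. -/
def estLFamilyNm1 (L T k u v : ℝ) {n : ℕ} (x : Fin n → ℝ) : ℝ :=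
  (T - L - u * devL T k x) / (3 * Real.sqrt (sampleVarNm1 x + v * devL T k x ^ 2))

/-- `Ĉ_{pu,n}`: the member `(u, v) = (0, 0)` of the family, that is `(U - T) / (3 S_n)`. -/
def estCpuN (U T k : ℝ) {n : ℕ} (x : Fin n → ℝ) : ℝ := estUFamilyN U T k 0 0 x

/-- `Ĉ_{pu,n-1}`: the member `(u, v) = (0, 0)` of the family, that is
`(U - T) / (3 S_{n-1})`. -/
def estCpuNm1 (U T k : ℝ) {n : ℕ} (x : Fin n → ℝ) : ℝ := estUFamilyNm1 U T k 0 0 x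

/-- `Ĉ_{pl,n}`: the member `(u, v) = (0, 0)` of the family, that is `(T - L) / (3 S_n)`. -/
def estCplN (L T k : ℝ) {n : ℕ} (x : Fin n → ℝ) : ℝ := estLFamilyN L T k 0 0 x

/-- `Ĉ_{pl,n-1}`: the member `(u, v) = (0, 0)` of the family, that is
`(T - L) / (3 S_{n-1})`. -/
def estCplNm1 (L T k : ℝ) {n : ℕ} (x : Fin n → ℝ) : ℝ := estLFamilyNm1 L T k 0 0 x

/-- The density claimed for the estimators with divisor `n - 1`; `C` is the true index. -/
def densityNm1 (n : ℕ) (C x : ℝ) : ℝ :=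
  if 0 < x then
    ((n : ℝ) - 1) ^ (((n : ℝ) - 1) / 2) /
        (C * Real.Gamma (((n : ℝ) - 1) / 2) * (2 : ℝ) ^ (((n : ℝ) - 3) / 2)) *
      (C / x) ^ n * Real.exp (-(((n : ℝ) - 1) / 2 * (C / x) ^ 2))
  else 0

/-- The density claimed for the estimators with divisor `n`; `C` is the true index. -/
def densityN (n : ℕ) (C x : ℝ) : ℝ :=
  if 0 < x then
    (n : ℝ) ^ (((n : ℝ) - 1) / 2) /
        (C * Real.Gamma (((n : ℝ) - 1) / 2) * (2 : ℝ) ^ (((n : ℝ) - 3) / 2)) *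
      (C / x) ^ n * Real.exp (-((n : ℝ) / 2 * (C / x) ^ 2))
  else 0

/-- The constant `b_f`. -/
def bf (n : ℕ) : ℝ :=
  Real.sqrt (2 / ((n : ℝ) - 1)) * Real.Gamma (((n : ℝ) - 1) / 2) / Real.Gamma (((n : ℝ) - 2) / 2)

/-- The constant `c_f`. -/
def cf (n : ℕ) : ℝ :=
  Real.sqrt (2 / (n : ℝ)) * Real.Gamma (((n : ℝ) - 1) / 2) / Real.Gamma (((n : ℝ) - 2) / 2)

/-- The real random variable `Y` has Lebesgue density `f` under `P`. -/
def HasDensity {Ω : Type*} [MeasurableSpace Ω] (P : Measure Ω) (Y : Ω → ℝ) (f : ℝ → ℝ) : Prop :=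
  HasLaw Y (volume.withDensity fun x => ENNReal.ofReal (f x)) P

end Capability

end

open Capability

/-!
The sum of squared deviations from the sample mean, divided by `σ ^ 2`, is the squared norm of the
projection of a standard Gaussian vector onto the hyperplane `∑ i, x i = 0`, itself a standard
Gaussian vector in dimension `n - 1`. Its law is therefore the gamma law of shape `(n - 1) / 2` and
rate `1 / 2`, which is recognised by its moment generating function near `0`. Hence every estimator
is `C / √V` with `V` gamma distributed of shape `(n - 1) / 2` and rate `m / 2`, where `C` is the
true index and `m` the divisor of the sample variance: the density follows from the change of
variables `v = (C / x) ^ 2`, and the moments are the moments of `V` of negative half-integer order.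
-/

open Filter Topology Complex in
theorem map_eq_map_of_mgf_eventuallyEq {Ω Ω' : Type*} [MeasurableSpace Ω] [MeasurableSpace Ω']
    {P : Measure Ω} {P' : Measure Ω'} [IsProbabilityMeasure P] [IsProbabilityMeasure P']
    {X : Ω → ℝ} {Y : Ω' → ℝ} (hX : AEMeasurable X P) (hY : AEMeasurable Y P')
    (h0 : 0 ∈ interior (integrableExpSet X P)) (hXY : mgf X P =ᶠ[𝓝 0] mgf Y P') :
    P.map X = P'.map Y := by
  have h0' : 0 ∈ interior (integrableExpSet Y P') := by
    rw [mem_interior_iff_mem_nhds] at h0 ⊢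
    filter_upwards [h0, hXY] with t ht heq
    exact mgf_pos_iff.1 (heq ▸ mgf_pos ht)
  set J := interior (integrableExpSet X P) ∩ interior (integrableExpSet Y P')
  have hJ : IsPreconnected {z : ℂ | z.re ∈ J} :=
    ((convex_integrableExpSet.interior.inter convex_integrableExpSet.interior).linear_preimage
      reLm).isPreconnected
  have hreal : ∃ᶠ t : ℝ in 𝓝[≠] 0, complexMGF X P t = complexMGF Y P' t :=
    (hXY.filter_mono nhdsWithin_le_nhds).frequently.mono fun t ht => by
      rw [complexMGF_ofReal, complexMGF_ofReal, ht]
  have hcomplex : ∃ᶠ z : ℂ in 𝓝[≠] 0, complexMGF X P z = complexMGF Y P' z := by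
    refine (tendsto_nhdsWithin_iff.2 ⟨?_, ?_⟩ : Tendsto ofReal (𝓝[≠] 0) (𝓝[≠] 0)).frequently hreal
    · exact (continuous_ofReal.tendsto' 0 0 ofReal_zero).mono_left nhdsWithin_le_nhds
    · filter_upwards [self_mem_nhdsWithin] with t ht using ofReal_ne_zero.2 ht
  -- identity theorem: the strip is connected and the zeros of the difference accumulate at `0`
  have hstrip : Set.EqOn (complexMGF X P) (complexMGF Y P') {z | z.re ∈ J} :=
    (analyticOnNhd_complexMGF.mono fun _ hz => hz.1).eqOn_of_preconnected_of_frequently_eq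
      (analyticOnNhd_complexMGF.mono fun _ hz => hz.2) hJ ⟨h0, h0'⟩ hcomplex
  have := Measure.isProbabilityMeasure_map hX
  have := Measure.isProbabilityMeasure_map hY
  refine Measure.ext_of_charFun (funext fun t => ?_)
  rw [← complexMGF_mul_I hX, ← complexMGF_mul_I hY]
  refine hstrip ?_
  change (t * I).re ∈ J
  simpa only [mul_I_re, ofReal_im, neg_zero] using Set.mem_inter h0 h0'

theorem map_withDensity_restrict_image {f : ℝ → ENNReal} {g h h' : ℝ → ℝ} {s : Set ℝ}
    (hs : MeasurableSet s) (hg : Measurable g) (hh : ∀ x ∈ s, HasDerivWithinAt h (h' x) s x)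
    (hgh : Set.LeftInvOn g h s) :
    ((volume.restrict (h '' s)).withDensity f).map g =
      (volume.restrict s).withDensity fun x => ENNReal.ofReal |h' x| * f (h x) := by
  ext u hu
  rw [Measure.map_apply hg hu, withDensity_apply _ (hg hu), withDensity_apply _ hu,
    Measure.restrict_restrict (hg hu), Measure.restrict_restrict hu, ← hgh.image_inter',
    lintegral_image_eq_lintegral_abs_deriv_mul (hu.inter hs)
      (fun x hx => (hh x hx.2).mono Set.inter_subset_right)
      (hgh.injOn.mono Set.inter_subset_right)]

section Gamma

variable {a r : ℝ}

theorem gammaMeasure_eq_withDensity_restrict (a r : ℝ) :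
    gammaMeasure a r = (volume.restrict (Set.Ioi 0)).withDensity fun x =>
      ENNReal.ofReal (r ^ a / Real.Gamma a * x ^ (a - 1) * Real.exp (-(r * x))) := by
  rw [gammaMeasure, restrict_Ioi_eq_restrict_Ici, ← withDensity_indicator measurableSet_Ici]
  congr 1 with x
  by_cases hx : 0 ≤ x <;> simp [gammaPDF_eq, hx]

theorem ae_gammaMeasure_pos (a r : ℝ) : ∀ᵐ x ∂gammaMeasure a r, 0 < x := by
  rw [gammaMeasure_eq_withDensity_restrict]
  exact (withDensity_absolutelyContinuous _ _).ae_le (ae_restrict_mem measurableSet_Ioi)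

theorem integral_gammaMeasure (ha : 0 < a) (hr : 0 < r) (f : ℝ → ℝ) :
    ∫ x, f x ∂gammaMeasure a r =
      r ^ a / Real.Gamma a * ∫ x in Set.Ioi 0, x ^ (a - 1) * Real.exp (-(r * x)) * f x := by
  rw [gammaMeasure_eq_withDensity_restrict, integral_withDensity_eq_integral_toReal_smul
    (by fun_prop) (ae_of_all _ fun _ => ENNReal.ofReal_lt_top), ← integral_const_mul]
  refine setIntegral_congr_fun measurableSet_Ioi fun x (hx : 0 < x) => ?_
  simp only [smul_eq_mul]
  rw [ENNReal.toReal_ofReal (by positivity)]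
  ring

theorem integral_rpow_mul_exp_gammaMeasure (ha : 0 < a) (hr : 0 < r) {s t : ℝ} (hs : 0 < a + s)
    (ht : t < r) :
    ∫ x, x ^ s * Real.exp (t * x) ∂gammaMeasure a r =
      r ^ a / Real.Gamma a * ((1 / (r - t)) ^ (a + s) * Real.Gamma (a + s)) := by
  rw [integral_gammaMeasure ha hr, ← Real.integral_rpow_mul_exp_neg_mul_Ioi hs (sub_pos.2 ht)]
  congr 1
  refine setIntegral_congr_fun measurableSet_Ioi fun x (hx : 0 < x) => ?_
  rw [show a + s - 1 = (a - 1) + s by ring, Real.rpow_add hx,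
    show -((r - t) * x) = -(r * x) + t * x by ring, Real.exp_add]
  ring

theorem integral_rpow_gammaMeasure (ha : 0 < a) (hr : 0 < r) {s : ℝ} (hs : 0 < a + s) :
    ∫ x, x ^ s ∂gammaMeasure a r = r ^ (-s) * (Real.Gamma (a + s) / Real.Gamma a) := by
  have h := integral_rpow_mul_exp_gammaMeasure ha hr hs hr
  simp only [zero_mul, Real.exp_zero, mul_one, sub_zero] at h
  rw [h, one_div, Real.inv_rpow hr.le, Real.rpow_add hr, Real.rpow_neg hr.le]
  field_simp

theorem integrable_rpow_gammaMeasure (ha : 0 < a) (hr : 0 < r) {s : ℝ} (hs : 0 < a + s) :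
    Integrable (fun x => x ^ s) (gammaMeasure a r) := by
  refine .of_integral_ne_zero ?_
  rw [integral_rpow_gammaMeasure ha hr hs]
  positivity

theorem mgf_id_gammaMeasure (ha : 0 < a) (hr : 0 < r) {t : ℝ} (ht : t < r) :
    mgf id (gammaMeasure a r) t = (r / (r - t)) ^ a := by
  have h := integral_rpow_mul_exp_gammaMeasure ha hr (s := 0) (by linarith) ht
  have hΓ := (Real.Gamma_pos_of_pos ha).ne'
  simp only [Real.rpow_zero, one_mul, add_zero] at h
  rw [mgf]
  simp only [id_eq]
  rw [h, one_div, Real.inv_rpow (sub_pos.2 ht).le, Real.div_rpow hr.le (sub_pos.2 ht).le]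
  field_simp

open Topology in
theorem hasLaw_gammaMeasure_of_mgf_eventuallyEq {Ω : Type*} [MeasurableSpace Ω] {P : Measure Ω}
    [IsProbabilityMeasure P] {X : Ω → ℝ} (ha : 0 < a) (hr : 0 < r) (hX : AEMeasurable X P)
    (hmgf : mgf X P =ᶠ[𝓝 0] fun t => (r / (r - t)) ^ a) : HasLaw X (gammaMeasure a r) P := by
  have := isProbabilityMeasure_gammaMeasure ha hr
  have hint : Set.Iio r ⊆ integrableExpSet id (gammaMeasure a r) := fun t (ht : t < r) => by
    rw [integrableExpSet, Set.mem_ofPred_eq, ← mgf_pos_iff, mgf_id_gammaMeasure ha hr ht]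
    have := sub_pos.2 ht
    positivity
  refine ⟨hX, ?_⟩
  rw [← map_eq_map_of_mgf_eventuallyEq aemeasurable_id hX
    (interior_maximal hint isOpen_Iio hr), Measure.map_id]
  filter_upwards [Iio_mem_nhds hr, hmgf] with t ht hXt
  rw [hXt, mgf_id_gammaMeasure ha hr ht]

end Gamma

section DivSqrtGamma

variable {Ω : Type*} [MeasurableSpace Ω] {P : Measure Ω} {V : Ω → ℝ} {a r c : ℝ}

open Topology in
theorem hasLaw_div_const_gammaMeasure [IsProbabilityMeasure P] (ha : 0 < a) (hr : 0 < r)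
    (hc : 0 < c) (hV : HasLaw V (gammaMeasure a r) P) :
    HasLaw (fun ω => V ω / c) (gammaMeasure a (c * r)) P := by
  refine hasLaw_gammaMeasure_of_mgf_eventuallyEq ha (by positivity)
    (hV.aemeasurable.div_const c) ?_
  have hmgf : mgf V P = mgf id (gammaMeasure a r) := by
    rw [← hV.map_eq, mgf_id_map hV.aemeasurable]
  filter_upwards [Iio_mem_nhds (mul_pos hc hr)] with t ht
  simp only [div_eq_inv_mul]
  rw [mgf_const_mul, hmgf, mgf_id_gammaMeasure ha hr ((inv_mul_lt_iff₀ hc).2 ht)]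
  field_simp

theorem image_div_sq_Ioi (hc : 0 < c) : (fun x : ℝ => (c / x) ^ 2) '' Set.Ioi 0 = Set.Ioi 0 := by
  refine Set.Subset.antisymm ?_ fun y (hy : 0 < y) => ⟨c / √y, Set.mem_Ioi.2 (by positivity), ?_⟩
  · rintro _ ⟨x, hx : 0 < x, rfl⟩
    exact Set.mem_Ioi.2 (by positivity)
  · simp only
    rw [div_div_cancel₀ hc.ne', Real.sq_sqrt hy.le]

theorem map_div_sqrt_gammaMeasure (hc : 0 < c) :
    (gammaMeasure a r).map (fun y => c / √y) = (volume.restrict (Set.Ioi 0)).withDensity fun x =>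
      ENNReal.ofReal |-(2 * c ^ 2 / x ^ 3)| * ENNReal.ofReal
        (r ^ a / Real.Gamma a * ((c / x) ^ 2) ^ (a - 1) * Real.exp (-(r * (c / x) ^ 2))) := by
  have hderiv : ∀ x ∈ Set.Ioi (0 : ℝ), HasDerivWithinAt (fun x : ℝ => (c / x) ^ 2)
      (-(2 * c ^ 2 / x ^ 3)) (Set.Ioi 0) x := fun x (hx : 0 < x) => by
    refine ((((hasDerivAt_inv hx.ne').const_mul c).pow 2).congr_deriv ?_).hasDerivWithinAt
    simp only [Nat.cast_ofNat, Nat.add_one_sub_one, pow_one]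
    field_simp
  have hinv : Set.LeftInvOn (fun y => c / √y) (fun x : ℝ => (c / x) ^ 2) (Set.Ioi 0) :=
    fun x (hx : 0 < x) => by
      simp only
      rw [Real.sqrt_sq (by positivity), div_div_cancel₀ hc.ne']
  have hmap := map_withDensity_restrict_image (f := fun y => ENNReal.ofReal
    (r ^ a / Real.Gamma a * y ^ (a - 1) * Real.exp (-(r * y)))) measurableSet_Ioi (by fun_prop)
    hderiv hinv
  rwa [image_div_sq_Ioi hc, ← gammaMeasure_eq_withDensity_restrict] at hmap

theorem hasDensity_div_sqrt_of_hasLaw_gammaMeasure (hc : 0 < c)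
    (hV : HasLaw V (gammaMeasure a r) P) :
    HasDensity P (fun ω => c / √(V ω)) fun x => if 0 < x then
      2 * r ^ a / Real.Gamma a * ((c / x) ^ (2 * a) / x) * Real.exp (-(r * (c / x) ^ 2))
      else 0 := by
  refine HasLaw.fun_comp (Y := fun y => c / √y) ⟨by fun_prop, ?_⟩ hV
  rw [map_div_sqrt_gammaMeasure hc, ← withDensity_indicator measurableSet_Ioi]
  congr 1 with x
  by_cases hx : 0 < x
  · have hpow : (c / x) ^ (2 * a) = (c / x) ^ 2 * ((c / x) ^ 2) ^ (a - 1) := by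
      rw [Real.rpow_mul (by positivity), Real.rpow_two, Real.rpow_sub_one (by positivity)]
      field_simp
    simp only [Set.indicator_of_mem (Set.mem_Ioi.2 hx), if_pos hx, hpow]
    rw [← ENNReal.ofReal_mul (abs_nonneg _), abs_neg, abs_of_pos (by positivity)]
    congr 1
    field_simp
  · simp [hx]

theorem ae_div_sqrt_pow_eq_gammaMeasure (a r c : ℝ) (k : ℕ) :
    (fun x => (c / √x) ^ k) =ᵐ[gammaMeasure a r] fun x => c ^ k * x ^ (-(k / 2 : ℝ)) := by
  filter_upwards [ae_gammaMeasure_pos a r] with x hx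
  rw [Real.rpow_neg hx.le, Real.rpow_div_two_eq_sqrt _ hx.le, Real.rpow_natCast, div_pow,
    div_eq_mul_inv]

theorem integrable_div_sqrt_pow_of_hasLaw_gammaMeasure (ha : 0 < a) (hr : 0 < r)
    (hV : HasLaw V (gammaMeasure a r) P) (c : ℝ) {k : ℕ} (hk : (k : ℝ) / 2 < a) :
    Integrable (fun ω => (c / √(V ω)) ^ k) P := by
  have h : Integrable (fun x => (c / √x) ^ k) (P.map V) := by
    rw [hV.map_eq, integrable_congr (ae_div_sqrt_pow_eq_gammaMeasure a r c k)]
    exact (integrable_rpow_gammaMeasure ha hr (by linarith)).const_mul _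
  exact h.comp_aemeasurable hV.aemeasurable

theorem integral_div_sqrt_pow_of_hasLaw_gammaMeasure (ha : 0 < a) (hr : 0 < r)
    (hV : HasLaw V (gammaMeasure a r) P) (c : ℝ) {k : ℕ} (hk : (k : ℝ) / 2 < a) :
    ∫ ω, (c / √(V ω)) ^ k ∂P =
      r ^ ((k : ℝ) / 2) * (Real.Gamma (a - k / 2) / Real.Gamma a) * c ^ k := by
  calc ∫ ω, (c / √(V ω)) ^ k ∂P
      = ∫ x, (c / √x) ^ k ∂gammaMeasure a r :=
        hV.integral_comp (f := fun x => (c / √x) ^ k)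
          (by fun_prop : Measurable fun x => (c / √x) ^ k).aestronglyMeasurable
    _ = c ^ k * ∫ x, x ^ (-(k / 2 : ℝ)) ∂gammaMeasure a r := by
        rw [integral_congr_ae (ae_div_sqrt_pow_eq_gammaMeasure a r c k), integral_const_mul]
    _ = r ^ ((k : ℝ) / 2) * (Real.Gamma (a - k / 2) / Real.Gamma a) * c ^ k := by
        rw [integral_rpow_gammaMeasure ha hr (by linarith), neg_neg, ← sub_eq_add_neg, mul_comm]

theorem memLp_two_div_sqrt_of_hasLaw_gammaMeasure (ha : 1 < a) (hr : 0 < r)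
    (hV : HasLaw V (gammaMeasure a r) P) (c : ℝ) : MemLp (fun ω => c / √(V ω)) 2 P := by
  have hmeas : AEMeasurable (fun ω => c / √(V ω)) P := hV.aemeasurable.sqrt.const_div c
  refine (memLp_two_iff_integrable_sq hmeas.aestronglyMeasurable).2 ?_
  exact integrable_div_sqrt_pow_of_hasLaw_gammaMeasure (by linarith) hr hV c (by simpa using ha)

theorem variance_div_sqrt_of_hasLaw_gammaMeasure [IsProbabilityMeasure P] (ha : 1 < a)
    (hr : 0 < r) (hV : HasLaw V (gammaMeasure a r) P) (c : ℝ) :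
    variance (fun ω => c / √(V ω)) P =
      (r / (a - 1) - (√r * (Real.Gamma (a - 1 / 2) / Real.Gamma a)) ^ 2) * c ^ 2 := by
  have ha' : 0 < a - 1 := by linarith
  have hmean := integral_div_sqrt_pow_of_hasLaw_gammaMeasure (by linarith) hr hV c (k := 1)
    (by norm_num; linarith)
  have hsq := integral_div_sqrt_pow_of_hasLaw_gammaMeasure (by linarith) hr hV c (k := 2)
    (by simpa using ha)
  have hΓ : Real.Gamma a = (a - 1) * Real.Gamma (a - 1) := by
    rw [← Real.Gamma_add_one ha'.ne', sub_add_cancel]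
  have : 0 < Real.Gamma (a - 1) := Real.Gamma_pos_of_pos ha'
  have hratio : Real.Gamma (a - 1) / Real.Gamma a = 1 / (a - 1) := by
    rw [hΓ]
    field_simp
  simp only [Nat.cast_one, pow_one, ← Real.sqrt_eq_rpow] at hmean
  simp only [Nat.cast_ofNat, div_self (two_ne_zero' ℝ), Real.rpow_one, hratio] at hsq
  rw [variance_eq_sub (memLp_two_div_sqrt_of_hasLaw_gammaMeasure ha hr hV c)]
  simp only [Pi.pow_apply]
  rw [hmean, hsq]
  ring

end DivSqrtGamma

section ChiSquared

theorem mgf_sq_gaussianReal {t : ℝ} (ht : t < 1 / 2) :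
    mgf (fun x => x ^ 2) (gaussianReal 0 1) t = (1 / 2 / (1 / 2 - t)) ^ (1 / 2 : ℝ) := by
  have : 0 < 1 / 2 - t := by linarith
  have hexp : ∀ x : ℝ, gaussianPDFReal 0 1 x • Real.exp (t * x ^ 2) =
      (√(2 * Real.pi))⁻¹ * Real.exp (-(1 / 2 - t) * x ^ 2) := fun x => by
    rw [gaussianPDFReal, smul_eq_mul, mul_assoc, ← Real.exp_add, NNReal.coe_one]
    ring_nf
  rw [mgf, integral_gaussianReal_eq_integral_smul one_ne_zero]
  simp only [hexp]
  rw [integral_const_mul, integral_gaussian, ← Real.sqrt_inv, ← Real.sqrt_mul (by positivity),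
    Real.sqrt_eq_rpow]
  congr 1
  field_simp

open Topology in
theorem hasLaw_sum_sq_of_iIndepFun {Ω ι : Type*} [MeasurableSpace Ω] {P : Measure Ω} [Fintype ι]
    [Nonempty ι] {Z : ι → Ω → ℝ} (hindep : iIndepFun Z P)
    (hlaw : ∀ i, HasLaw (Z i) (gaussianReal 0 1) P) :
    HasLaw (fun ω => ∑ i, Z i ω ^ 2) (gammaMeasure ((Fintype.card ι : ℝ) / 2) (1 / 2)) P := by
  have := hindep.isProbabilityMeasure
  have hmeas : ∀ i, AEMeasurable (fun ω => Z i ω ^ 2) P := fun i =>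
    (hlaw i).aemeasurable.pow_const 2
  have hmgf : ∀ i, ∀ t < 1 / 2,
      mgf (fun ω => Z i ω ^ 2) P t = (1 / 2 / (1 / 2 - t)) ^ (1 / 2 : ℝ) := fun i t ht => by
    rw [← mgf_sq_gaussianReal ht, ← (hlaw i).map_eq, mgf_map (hlaw i).aemeasurable (by fun_prop)]
    rfl
  refine hasLaw_gammaMeasure_of_mgf_eventuallyEq (by positivity) (by norm_num)
    (Finset.aemeasurable_fun_sum _ fun i _ => hmeas i) ?_
  filter_upwards [Iio_mem_nhds (show (0 : ℝ) < 1 / 2 by norm_num)] with t (ht : t < 1 / 2)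
  have : 0 < 1 / 2 - t := by linarith
  have hsum := (hindep.comp (fun _ x => x ^ 2) fun _ => by fun_prop).mgf_sum₀ (t := t) hmeas
    Finset.univ
  simp only [Function.comp_def, hmgf _ t ht, Finset.prod_const, Finset.card_univ] at hsum
  rw [← Real.rpow_mul_natCast (by positivity)] at hsum
  convert hsum using 2
  · ext; simp
  · ring

end ChiSquared

section StdGaussian

variable {E : Type*} [NormedAddCommGroup E] [InnerProductSpace ℝ E] [FiniteDimensional ℝ E]
  [MeasurableSpace E] [BorelSpace E]

theorem hasLaw_norm_sq_stdGaussian [Nontrivial E] :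
    HasLaw (fun x : E => ‖x‖ ^ 2) (gammaMeasure ((Module.finrank ℝ E : ℝ) / 2) (1 / 2))
      (stdGaussian E) := by
  have hcoord : iIndepFun (fun (i : Fin (Module.finrank ℝ E)) (x : Fin (Module.finrank ℝ E) → ℝ) =>
      x i) (Measure.pi fun _ => gaussianReal 0 1) := iIndepFun_pi fun _ => aemeasurable_id
  have : Nonempty (Fin (Module.finrank ℝ E)) := Fin.pos_iff_nonempty.1 Module.finrank_pos
  have h := hasLaw_sum_sq_of_iIndepFun hcoord fun i =>
    (measurePreserving_eval (fun _ => gaussianReal 0 1) i).hasLaw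
  refine ⟨by fun_prop, ?_⟩
  rw [stdGaussian, Measure.map_map (by fun_prop) (by fun_prop)]
  convert h.map_eq using 2
  · ext x
    simp [← (stdOrthonormalBasis ℝ E).sum_sq_norm_inner_right,
      (stdOrthonormalBasis ℝ E).orthonormal.inner_right_fintype]
  · simp

theorem stdGaussian_map_orthogonalProjectionOnto (K : Submodule ℝ E) :
    (stdGaussian E).map K.orthogonalProjectionOnto = stdGaussian K := by
  have := Measure.isProbabilityMeasure_map (μ := stdGaussian E)
    (f := K.orthogonalProjectionOnto) (by fun_prop)
  refine Measure.ext_of_charFun (funext fun t => ?_)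
  have h := charFun_stdGaussian (t : E)
  rw [charFun_apply, ← Submodule.coe_norm] at h
  rw [charFun_apply, integral_map (by fun_prop) (by fun_prop), charFun_stdGaussian]
  simpa only [Submodule.inner_orthogonalProjectionOnto_eq_of_mem_right] using h

end StdGaussian

section Sample

/-- The hyperplane of `ℝⁿ` orthogonal to the all-ones vector. Orthogonal projection onto it turns
a sample into the vector of its deviations from the sample mean. -/
noncomputable def centeredSubspace (n : ℕ) : Submodule ℝ (EuclideanSpace ℝ (Fin n)) :=
  (Submodule.span ℝ {WithLp.toLp 2 fun _ => (1 : ℝ)})ᗮ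

variable {n : ℕ}

theorem finrank_centeredSubspace [NeZero n] : Module.finrank ℝ (centeredSubspace n) = n - 1 := by
  have : Fact (Module.finrank ℝ (EuclideanSpace ℝ (Fin n)) = (n - 1) + 1) :=
    ⟨by rw [finrank_euclideanSpace_fin, Nat.sub_add_cancel NeZero.one_le]⟩
  refine Submodule.finrank_orthogonal_span_singleton fun h => ?_
  simpa using congrArg (fun v : EuclideanSpace ℝ (Fin n) => v 0) h

theorem coe_orthogonalProjectionOnto_centeredSubspace (x : Fin n → ℝ) :
    ((centeredSubspace n).orthogonalProjectionOnto (WithLp.toLp 2 x) : EuclideanSpace ℝ (Fin n)) =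
      WithLp.toLp 2 fun i => x i - sampleMean x := by
  rw [← Submodule.starProjection_apply, centeredSubspace, Submodule.starProjection_orthogonal_val,
    Submodule.starProjection_singleton]
  ext i
  simp [PiLp.inner_apply, EuclideanSpace.real_norm_sq_eq, sampleMean]

theorem norm_sq_orthogonalProjectionOnto_centeredSubspace (x : Fin n → ℝ) :
    ‖(centeredSubspace n).orthogonalProjectionOnto (WithLp.toLp 2 x)‖ ^ 2 =
      ∑ i, (x i - sampleMean x) ^ 2 := by
  rw [Submodule.coe_norm, coe_orthogonalProjectionOnto_centeredSubspace,
    EuclideanSpace.real_norm_sq_eq]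

theorem sampleMean_sub_div [NeZero n] (x : Fin n → ℝ) (a b : ℝ) :
    (sampleMean fun i => (x i - a) / b) = (sampleMean x - a) / b := by
  have hn : (n : ℝ) ≠ 0 := NeZero.ne _
  simp only [sampleMean, ← Finset.sum_div, Finset.sum_sub_distrib, Finset.sum_const,
    Finset.card_univ, Fintype.card_fin, nsmul_eq_mul]
  field_simp

theorem sum_sq_sub_sampleMean_standardize [NeZero n] (x : Fin n → ℝ) (a b : ℝ) :
    ∑ i, ((x i - a) / b - sampleMean fun j => (x j - a) / b) ^ 2 =
      (∑ i, (x i - sampleMean x) ^ 2) / b ^ 2 := by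
  rw [Finset.sum_div]
  refine Finset.sum_congr rfl fun i _ => ?_
  rw [sampleMean_sub_div, ← sub_div, sub_sub_sub_cancel_right, div_pow]

variable {Ω : Type*} [MeasurableSpace Ω] {P : Measure Ω} {X : Fin n → Ω → ℝ}

theorem hasLaw_sum_sq_sub_sampleMean_of_stdGaussian (hn : 2 ≤ n) (hindep : iIndepFun X P)
    (hlaw : ∀ i, HasLaw (X i) (gaussianReal 0 1) P) :
    HasLaw (fun ω => ∑ i, (X i ω - sampleMean fun j => X j ω) ^ 2)
      (gammaMeasure (((n : ℝ) - 1) / 2) (1 / 2)) P := by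
  have : NeZero n := ⟨by omega⟩
  have hdim : Module.finrank ℝ (centeredSubspace n) = n - 1 := finrank_centeredSubspace
  have : Nontrivial (centeredSubspace n) := Module.nontrivial_of_finrank_pos (R := ℝ) (by omega)
  have hpi : HasLaw (WithLp.toLp 2) (stdGaussian (EuclideanSpace ℝ (Fin n)))
      (Measure.pi fun _ : Fin n => gaussianReal 0 1) := ⟨by fun_prop, map_pi_eq_stdGaussian⟩
  have hproj : HasLaw (centeredSubspace n).orthogonalProjectionOnto
      (stdGaussian (centeredSubspace n)) (stdGaussian (EuclideanSpace ℝ (Fin n))) :=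
    ⟨by fun_prop, stdGaussian_map_orthogonalProjectionOnto _⟩
  have h := hasLaw_norm_sq_stdGaussian.comp (hproj.comp (hpi.comp (hindep.hasLaw_pi hlaw)))
  rw [hdim, Nat.cast_sub NeZero.one_le, Nat.cast_one] at h
  convert h using 2 with ω
  exact (norm_sq_orthogonalProjectionOnto_centeredSubspace _).symm

open NNReal in
theorem hasLaw_sum_sq_sub_sampleMean_div_variance (hn : 2 ≤ n) {μ : ℝ} {v : ℝ≥0} (hv : v ≠ 0)
    (hindep : iIndepFun X P) (hlaw : ∀ i, HasLaw (X i) (gaussianReal μ v) P) :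
    HasLaw (fun ω => (∑ i, (X i ω - sampleMean fun j => X j ω) ^ 2) / v)
      (gammaMeasure (((n : ℝ) - 1) / 2) (1 / 2)) P := by
  have : NeZero n := ⟨by omega⟩
  have hstd : ∀ i, HasLaw (fun ω => (X i ω - μ) / √(v : ℝ)) (gaussianReal 0 1) P := fun i => by
    convert gaussianReal_div_const (gaussianReal_sub_const (hlaw i) μ) √(v : ℝ) using 2
    · simp
    · ext
      simp [hv]
  have h := hasLaw_sum_sq_sub_sampleMean_of_stdGaussian hn
    (hindep.comp (fun _ x => (x - μ) / √(v : ℝ)) fun _ => by fun_prop) hstd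
  simpa only [Function.comp_apply, sum_sq_sub_sampleMean_standardize, Real.sq_sqrt v.coe_nonneg]
    using h

end Sample

section IndexEstimator

/-- The density of `C / √V` when `V` has the gamma law of shape `(n - 1) / 2` and rate `m / 2`.
It specialises to `Capability.densityN` for `m = n` and to `Capability.densityNm1` for
`m = n - 1`. -/
noncomputable def indexDensity (n : ℕ) (m C x : ℝ) : ℝ :=
  if 0 < x then
    m ^ (((n : ℝ) - 1) / 2) /
        (C * Real.Gamma (((n : ℝ) - 1) / 2) * (2 : ℝ) ^ (((n : ℝ) - 3) / 2)) *
      (C / x) ^ n * Real.exp (-(m / 2 * (C / x) ^ 2))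
  else 0

/-- The factor correcting the bias of an index estimator built from the sample variance with
divisor `m`. It specialises to `Capability.cf` for `m = n` and to `Capability.bf` for
`m = n - 1`. -/
noncomputable def biasFactor (n : ℕ) (m : ℝ) : ℝ :=
  √(2 / m) * Real.Gamma (((n : ℝ) - 1) / 2) / Real.Gamma (((n : ℝ) - 2) / 2)

variable {Ω : Type*} [MeasurableSpace Ω] {P : Measure Ω} {n : ℕ} {m C : ℝ} {Y V : Ω → ℝ}

/-- The distributional properties of the estimator `Y` of a capability index `C` built from the
variance, with divisor `m`, of a sample of size `n`: density, moments, mean and variance. -/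
def IsIndexEstimator (P : Measure Ω) (n : ℕ) (m C : ℝ) (Y : Ω → ℝ) : Prop :=
  HasDensity P Y (indexDensity n m C) ∧
    (∀ r : ℕ, r + 1 < n → Integrable (fun ω => Y ω ^ r) P ∧
      ∫ ω, Y ω ^ r ∂P = (m / 2) ^ ((r : ℝ) / 2) *
        (Real.Gamma (((n : ℝ) - 1 - r) / 2) / Real.Gamma (((n : ℝ) - 1) / 2)) * C ^ r) ∧
    (3 ≤ n → Integrable Y P ∧ ∫ ω, Y ω ∂P = (biasFactor n m)⁻¹ * C) ∧
    (4 ≤ n → MemLp Y 2 P ∧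
      variance Y P = (m / ((n : ℝ) - 3) - (biasFactor n m)⁻¹ ^ 2) * C ^ 2)

theorem indexDensity_of_pos {x : ℝ} (hm : 0 ≤ m) (hC : 0 < C) (hx : 0 < x) :
    indexDensity n m C x = 2 * (m / 2) ^ (((n : ℝ) - 1) / 2) / Real.Gamma (((n : ℝ) - 1) / 2) *
      ((C / x) ^ (2 * (((n : ℝ) - 1) / 2)) / x) * Real.exp (-(m / 2 * (C / x) ^ 2)) := by
  have hpow : (C / x) ^ (2 * (((n : ℝ) - 1) / 2)) = (C / x) ^ n / (C / x) := by
    rw [mul_div_cancel₀ _ two_ne_zero, Real.rpow_sub_one (by positivity), Real.rpow_natCast]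
  have htwo : (2 : ℝ) ^ (((n : ℝ) - 3) / 2) = 2 ^ (((n : ℝ) - 1) / 2) / 2 := by
    rw [← Real.rpow_sub_one two_ne_zero]
    ring_nf
  rw [indexDensity, if_pos hx, hpow, htwo, Real.div_rpow hm two_pos.le]
  field_simp

theorem inv_biasFactor (n : ℕ) (m : ℝ) :
    (biasFactor n m)⁻¹ =
      √(m / 2) * (Real.Gamma (((n : ℝ) - 2) / 2) / Real.Gamma (((n : ℝ) - 1) / 2)) := by
  rw [biasFactor, inv_div, ← inv_div m 2, Real.sqrt_inv, ← div_div, div_inv_eq_mul]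
  ring

theorem isIndexEstimator_div_sqrt [IsProbabilityMeasure P] (hn : 2 ≤ n) (hm : 0 < m) (hC : 0 < C)
    (hV : HasLaw V (gammaMeasure (((n : ℝ) - 1) / 2) (m / 2)) P) :
    IsIndexEstimator P n m C fun ω => C / √(V ω) := by
  have ha : 0 < ((n : ℝ) - 1) / 2 := half_pos (sub_pos.2 (by exact_mod_cast hn))
  have hmoment : ∀ r : ℕ, r + 1 < n → Integrable (fun ω => (C / √(V ω)) ^ r) P ∧
      ∫ ω, (C / √(V ω)) ^ r ∂P = (m / 2) ^ ((r : ℝ) / 2) *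
        (Real.Gamma (((n : ℝ) - 1 - r) / 2) / Real.Gamma (((n : ℝ) - 1) / 2)) * C ^ r :=
    fun r hr => by
      have hra : (r : ℝ) / 2 < ((n : ℝ) - 1) / 2 := by
        have : (r : ℝ) + 1 < n := by exact_mod_cast hr
        linarith
      refine ⟨integrable_div_sqrt_pow_of_hasLaw_gammaMeasure ha (half_pos hm) hV C hra, ?_⟩
      rw [integral_div_sqrt_pow_of_hasLaw_gammaMeasure ha (half_pos hm) hV C hra, sub_div _ (r : ℝ)]
  refine ⟨?_, hmoment, fun hn3 => ?_, fun hn4 => ?_⟩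
  · convert hasDensity_div_sqrt_of_hasLaw_gammaMeasure hC hV using 2 with x
    split_ifs with hx
    · exact indexDensity_of_pos hm.le hC hx
    · exact if_neg hx
  · obtain ⟨hint, hmean⟩ := hmoment 1 (by omega)
    simp only [pow_one] at hint hmean
    refine ⟨hint, ?_⟩
    rw [hmean, inv_biasFactor, Real.sqrt_eq_rpow, Nat.cast_one, sub_sub, one_add_one_eq_two]
  · have ha1 : 1 < ((n : ℝ) - 1) / 2 := by
      have : (4 : ℝ) ≤ n := by exact_mod_cast hn4
      linarith
    refine ⟨memLp_two_div_sqrt_of_hasLaw_gammaMeasure ha1 (half_pos hm) hV C, ?_⟩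
    rw [variance_div_sqrt_of_hasLaw_gammaMeasure ha1 (half_pos hm) hV, inv_biasFactor,
      show ((n : ℝ) - 1) / 2 - 1 = (n - 3) / 2 by ring, div_div_div_cancel_right₀ two_ne_zero,
      ← sub_div, sub_sub, one_add_one_eq_two]

open NNReal in
theorem isIndexEstimator_div_sqrt_sampleVar {X : Fin n → Ω → ℝ} {μ σ D : ℝ} {v : ℝ≥0}
    (hn : 2 ≤ n) (hσ : 0 < σ) (hv : (v : ℝ) = σ ^ 2) (hindep : iIndepFun X P)
    (hlaw : ∀ i, HasLaw (X i) (gaussianReal μ v) P) (hm : 0 < m) (hD : 0 < D) :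
    IsIndexEstimator P n m (D / (3 * σ)) fun ω =>
      D / (3 * √((∑ i, (X i ω - sampleMean fun j => X j ω) ^ 2) / m)) := by
  have := hindep.isProbabilityMeasure
  have ha : 0 < ((n : ℝ) - 1) / 2 := half_pos (sub_pos.2 (by exact_mod_cast hn))
  have hv0 : v ≠ 0 := NNReal.coe_ne_zero.1 (hv ▸ (pow_pos hσ 2).ne')
  have hV := hasLaw_div_const_gammaMeasure ha one_half_pos hm
    (hasLaw_sum_sq_sub_sampleMean_div_variance hn hv0 hindep hlaw)
  rw [mul_one_div] at hV
  convert isIndexEstimator_div_sqrt hn hm (C := D / (3 * σ)) (by positivity) hV using 2 with ω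
  rw [hv, div_right_comm _ (σ ^ 2), Real.sqrt_div' _ (sq_nonneg σ), Real.sqrt_sq hσ.le, div_div,
    mul_assoc, mul_div_cancel₀ _ hσ.ne']

end IndexEstimator

section CapabilityIndices

theorem Cpu_eq_two_div_one_add_mul_Cp {U L T k : ℝ} (σ : ℝ) (hk : 1 + k ≠ 0)
    (h : T - L = k * (U - T)) : Cpu U T σ = 2 / (1 + k) * Cp L U σ := by
  rw [Cpu, Cp, show U - L = (1 + k) * (U - T) by linarith]
  field_simp
  ring

theorem Cpl_eq_two_div_one_add_mul_Cp {U L T k : ℝ} (σ : ℝ) (hk : 1 + k ≠ 0)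
    (h : U - T = k * (T - L)) : Cpl L T σ = 2 / (1 + k) * Cp L U σ := by
  rw [Cpl, Cp, show U - L = (1 + k) * (T - L) by linarith]
  field_simp
  ring

variable {n : ℕ} (U L T k : ℝ)

theorem estCpuN_eq (x : Fin n → ℝ) : estCpuN U T k x = (U - T) / (3 * √(sampleVarN x)) := by
  simp [estCpuN, estUFamilyN]

theorem estCpuNm1_eq (x : Fin n → ℝ) :
    estCpuNm1 U T k x = (U - T) / (3 * √(sampleVarNm1 x)) := by
  simp [estCpuNm1, estUFamilyNm1]

theorem estCplN_eq (x : Fin n → ℝ) : estCplN L T k x = (T - L) / (3 * √(sampleVarN x)) := by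
  simp [estCplN, estLFamilyN]

theorem estCplNm1_eq (x : Fin n → ℝ) :
    estCplNm1 L T k x = (T - L) / (3 * √(sampleVarNm1 x)) := by
  simp [estCplNm1, estLFamilyNm1]

theorem sampleVarN_eq_mul_sampleVarNm1 (hn : n ≠ 1) (x : Fin n → ℝ) :
    sampleVarN x = ((n : ℝ) - 1) / n * sampleVarNm1 x := by
  have hn' : (n : ℝ) - 1 ≠ 0 := sub_ne_zero.2 (by exact_mod_cast hn)
  rw [sampleVarN, sampleVarNm1]
  field_simp

theorem div_three_mul_sqrt_sampleVarN (hn : 2 ≤ n) (D : ℝ) (x : Fin n → ℝ) :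
    D / (3 * √(sampleVarN x)) = √((n : ℝ) / (n - 1)) * (D / (3 * √(sampleVarNm1 x))) := by
  have hn' : 0 < (n : ℝ) - 1 := sub_pos.2 (by exact_mod_cast hn)
  rw [sampleVarN_eq_mul_sampleVarNm1 (by omega), Real.sqrt_mul (by positivity),
    ← inv_div (n : ℝ), Real.sqrt_inv]
  field_simp

end CapabilityIndices

theorem mainTheorem5 {Ω : Type*} [MeasurableSpace Ω] (P : Measure Ω) [IsProbabilityMeasure P]
    (n : ℕ) (hn : 2 ≤ n) (μ σ : ℝ) (hσ : 0 < σ) (T k : ℝ) (hk : 1 < k)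
    (X : Fin n → Ω → ℝ) (hindep : iIndepFun X P)
    (hlaw : ∀ i, HasLaw (X i) (gaussianReal μ ⟨σ ^ 2, sq_nonneg σ⟩) P) :
    (∀ U : ℝ, T < U →
      (∀ L : ℝ, T - L = k * (U - T) → Cpu U T σ = 2 / (1 + k) * Cp L U σ) ∧
      (HasDensity P (fun ω => estCpuNm1 U T k fun i => X i ω) (densityNm1 n (Cpu U T σ)) ∧
        (∀ r : ℕ, r + 1 < n →
          Integrable (fun ω => (estCpuNm1 U T k fun i => X i ω) ^ r) P ∧
          ∫ ω, (estCpuNm1 U T k fun i => X i ω) ^ r ∂P =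
            (((n : ℝ) - 1) / 2) ^ ((r : ℝ) / 2) *
              (Real.Gamma (((n : ℝ) - 1 - r) / 2) / Real.Gamma (((n : ℝ) - 1) / 2)) *
              (Cpu U T σ) ^ r) ∧
        (3 ≤ n →
          Integrable (fun ω => estCpuNm1 U T k fun i => X i ω) P ∧
          ∫ ω, estCpuNm1 U T k (fun i => X i ω) ∂P = (bf n)⁻¹ * Cpu U T σ) ∧
        (4 ≤ n →
          MemLp (fun ω => estCpuNm1 U T k fun i => X i ω) 2 P ∧
          variance (fun ω => estCpuNm1 U T k fun i => X i ω) P =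
            (((n : ℝ) - 1) / ((n : ℝ) - 3) - ((bf n)⁻¹) ^ 2) * (Cpu U T σ) ^ 2)) ∧
      (∀ x : Fin n → ℝ, estCpuN U T k x =
          Real.sqrt ((n : ℝ) / ((n : ℝ) - 1)) * estCpuNm1 U T k x) ∧
      (HasDensity P (fun ω => estCpuN U T k fun i => X i ω) (densityN n (Cpu U T σ)) ∧
        (∀ r : ℕ, r + 1 < n →
          Integrable (fun ω => (estCpuN U T k fun i => X i ω) ^ r) P ∧
          ∫ ω, (estCpuN U T k fun i => X i ω) ^ r ∂P =
            ((n : ℝ) / 2) ^ ((r : ℝ) / 2) *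
              (Real.Gamma (((n : ℝ) - 1 - r) / 2) / Real.Gamma (((n : ℝ) - 1) / 2)) *
              (Cpu U T σ) ^ r) ∧
        (3 ≤ n →
          Integrable (fun ω => estCpuN U T k fun i => X i ω) P ∧
          ∫ ω, estCpuN U T k (fun i => X i ω) ∂P = (cf n)⁻¹ * Cpu U T σ) ∧
        (4 ≤ n →
          MemLp (fun ω => estCpuN U T k fun i => X i ω) 2 P ∧
          variance (fun ω => estCpuN U T k fun i => X i ω) P =
            ((n : ℝ) / ((n : ℝ) - 3) - ((cf n)⁻¹) ^ 2) * (Cpu U T σ) ^ 2))) ∧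
    (∀ L : ℝ, L < T →
      (∀ U : ℝ, U - T = k * (T - L) → Cpl L T σ = 2 / (1 + k) * Cp L U σ) ∧
      (HasDensity P (fun ω => estCplNm1 L T k fun i => X i ω) (densityNm1 n (Cpl L T σ)) ∧
        (∀ r : ℕ, r + 1 < n →
          Integrable (fun ω => (estCplNm1 L T k fun i => X i ω) ^ r) P ∧
          ∫ ω, (estCplNm1 L T k fun i => X i ω) ^ r ∂P =
            (((n : ℝ) - 1) / 2) ^ ((r : ℝ) / 2) *
              (Real.Gamma (((n : ℝ) - 1 - r) / 2) / Real.Gamma (((n : ℝ) - 1) / 2)) *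
              (Cpl L T σ) ^ r) ∧
        (3 ≤ n →
          Integrable (fun ω => estCplNm1 L T k fun i => X i ω) P ∧
          ∫ ω, estCplNm1 L T k (fun i => X i ω) ∂P = (bf n)⁻¹ * Cpl L T σ) ∧
        (4 ≤ n →
          MemLp (fun ω => estCplNm1 L T k fun i => X i ω) 2 P ∧
          variance (fun ω => estCplNm1 L T k fun i => X i ω) P =
            (((n : ℝ) - 1) / ((n : ℝ) - 3) - ((bf n)⁻¹) ^ 2) * (Cpl L T σ) ^ 2)) ∧
      (∀ x : Fin n → ℝ, estCplN L T k x =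
          Real.sqrt ((n : ℝ) / ((n : ℝ) - 1)) * estCplNm1 L T k x) ∧
      (HasDensity P (fun ω => estCplN L T k fun i => X i ω) (densityN n (Cpl L T σ)) ∧
        (∀ r : ℕ, r + 1 < n →
          Integrable (fun ω => (estCplN L T k fun i => X i ω) ^ r) P ∧
          ∫ ω, (estCplN L T k fun i => X i ω) ^ r ∂P =
            ((n : ℝ) / 2) ^ ((r : ℝ) / 2) *
              (Real.Gamma (((n : ℝ) - 1 - r) / 2) / Real.Gamma (((n : ℝ) - 1) / 2)) *
              (Cpl L T σ) ^ r) ∧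
        (3 ≤ n →
          Integrable (fun ω => estCplN L T k fun i => X i ω) P ∧
          ∫ ω, estCplN L T k (fun i => X i ω) ∂P = (cf n)⁻¹ * Cpl L T σ) ∧
        (4 ≤ n →
          MemLp (fun ω => estCplN L T k fun i => X i ω) 2 P ∧
          variance (fun ω => estCplN L T k fun i => X i ω) P =
            ((n : ℝ) / ((n : ℝ) - 3) - ((cf n)⁻¹) ^ 2) * (Cpl L T σ) ^ 2))) := by
  have hn1 : (0 : ℝ) < (n : ℝ) - 1 := sub_pos.2 (by exact_mod_cast hn)
  have hn0 : (0 : ℝ) < n := by linarith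
  have hk1 : 1 + k ≠ 0 := by linarith
  have hest : ∀ D m : ℝ, 0 < D → 0 < m → IsIndexEstimator P n m (D / (3 * σ)) fun ω =>
      D / (3 * √((∑ i, (X i ω - sampleMean fun j => X j ω) ^ 2) / m)) :=
    fun D m hD hm => isIndexEstimator_div_sqrt_sampleVar hn hσ rfl hindep hlaw hm hD
  simp only [estCpuN_eq, estCpuNm1_eq, estCplN_eq, estCplNm1_eq]
  exact ⟨fun U hU => ⟨fun L => Cpu_eq_two_div_one_add_mul_Cp σ hk1,
      hest (U - T) (n - 1) (sub_pos.2 hU) hn1, div_three_mul_sqrt_sampleVarN hn (U - T),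
      hest (U - T) n (sub_pos.2 hU) hn0⟩,
    fun L hL => ⟨fun U => Cpl_eq_two_div_one_add_mul_Cp σ hk1,
      hest (T - L) (n - 1) (sub_pos.2 hL) hn1, div_three_mul_sqrt_sampleVarN hn (T - L),
      hest (T - L) n (sub_pos.2 hL) hn0⟩⟩
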